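/- Let $D>1$ and $k\ge 4$ be integers and let $\chi$ be a primitive Dirichlet character modulo $D$ with $\chi(-1)=(-1)^k$. Let $S_k(D,\chi)$ be the space of holomorphic cusp forms of weight $k$, level $D$ and nebentypus $\chi$, with the Petersson inner product over $\Gamma_0(D)\backslash\mathbb{H}$, and write the Fourier expansion of $f\in S_k(D,\chi)$ as $f(z)=\sum_{n\ge1}a_f(n)\,n^{(k-1)/2}e^{2\pi i nz}$. For $\operatorname{Re}s$ sufficiently large put $$\mathcal{L}(s,f)=\sum_{n\ge1}\frac{a_f(n)}{n^s},\qquad \overline{\mathcal{L}}(s,f)=\overline{\mathcal{L}(\overline{s},f)}=\sum_{n\ge1}\frac{\overline{a_f(n)}}{n^s}.$$ Suppose that $\mathcal{B}$ is an orthogonal basis of $S_k(D,\chi)$ such that every $f\in\mathcal{B}$ satisfies (1) $\overline{a_f(\ell)}=a_f(\ell)\overline{\chi(\ell)}$ for all $\ell\ge1$ with $(\ell,D)=1$, and (2) $a_f(nm)=a_f(n)a_f(m)$ for all $n\ge1$ and all $m\ge1$ dividing some power of $D$. Then for every $f\in\mathcal{B}$ the functions $\mathcal{L}(s,f)$ and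 $\overline{\mathcal{L}}(s,f)$ extend to entire functions of $s$ and satisfy the functional equation $$\mathcal{L}(s,f)=i^k\chi(-1)\,\epsilon_\chi\,\overline{a_f(D)}\,D^{1/2-s}\,\frac{\gamma_k(1-s)}{\gamma_k(s)}\,\overline{\mathcal{L}}(1-s,f),$$ where $$\epsilon_\chi=D^{-1/2}\sum_{\alpha \bmod D}\chi(\alpha)e^{2\pi i\alpha/D},\qquad \gamma_k(s)=2^{(3-k)/2}\sqrt{\pi}\,(2\pi)^{-s}\,\Gamma\Big(s+\frac{k-1}{2}\Big)=\pi^{-s}\,\Gamma\Big(\frac{s+\frac{k-1}{2}}{2}\Big)\Gamma\Big(\frac{s+\frac{k+1}{2}}{2}\Big).$$ The functional equation is an identity of meromorphic functions on $\mathbb{C}$: it holds at every $s\in\mathbb{C}$ that is not a pole of $\gamma_k(1-s)$ (that is, $s\ne\frac{k+1}{2}+m$ for all integers $m\ge0$), and after multiplication by the entire function $1/\gamma_k(1-s)$ it holds at every $s\in\mathbb{C}$. -/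

import Mathlib

open UpperHalfPlane MatrixGroups ModularForm CongruenceSubgroup ComplexConjugate

noncomputable section

namespace HeckeFE

/-- The space `S_k(D, χ)` of holomorphic cusp forms of weight `k`, level `D` and nebentypus `χ`:
the cusp forms `f` of weight `k` for `Γ₁(D)` such that
`f((az + b)/(cz + d)) = χ(d) (cz + d)^k f(z)` for every matrix `(a, b; c, d)` in `Γ₀(D)`. -/
def cuspSpace (k : ℤ) {D : ℕ} (χ : DirichletCharacter ℂ D) :
    Submodule ℂ (CuspForm ((Gamma1 D).map (Matrix.SpecialLinearGroup.mapGL ℝ)) k) where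
  carrier := {f | ∀ γ : Gamma0 D,
    (f : ℍ → ℂ) ∣[k] (γ : SL(2, ℤ)) = χ (Gamma0Map D γ) • (f : ℍ → ℂ)}
  zero_mem' := by
    intro γ
    simp
  add_mem' := by
    intro f g hf hg γ
    rw [FunLike.coe_add, SlashAction.add_slash, hf γ, hg γ, smul_add]
  smul_mem' := by
    intro c f hf γ
    rw [FunLike.coe_smul, ModularForm.SL_smul_slash, hf γ, smul_comm]

/-- The Petersson inner product
`⟪f, g⟫ = ∫_{Γ₀(D) \ ℍ} conj (f z) * g z * y ^ k dx dy / y ^ 2`.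
Here `volume` on `ℍ` is `dx dy / y ^ 2`, and the integral over `Γ₀(D) \ ℍ` is computed on the
fundamental domain of `Γ₀(D)` which is the union of the translates `γ⁻¹ • 𝒟` of the standard
fundamental domain `𝒟` of `SL(2, ℤ)`, for `γ` in a set of representatives of `SL(2, ℤ) ⧸ Γ₀(D)`.
As the integrand is `Γ₀(D)`-invariant for `f, g` in `S_k(D, χ)`, the representatives do not
matter. -/
def peterssonInner (k : ℤ) (D : ℕ) (f g : ℍ → ℂ) : ℂ :=
  ∑ᶠ q : SL(2, ℤ) ⧸ Gamma0 D,
    ∫ z in ModularGroup.fd, petersson k f g ((q.out : SL(2, ℤ))⁻¹ • z)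

/-- The normalized Fourier coefficients `a_f(n)` (`n ≥ 1`), defined by
`f(z) = ∑_{n ≥ 1} a_f(n) n^((k-1)/2) e(nz)`. -/
def coeffA (k : ℤ) (f : ℍ → ℂ) (n : ℕ) : ℂ :=
  (qExpansion 1 f).coeff n / (n : ℂ) ^ (((k : ℂ) - 1) / 2)

/-- An orthogonal basis of `S_k(D, χ)`, all of whose members `f` satisfy
`conj (a_f(ℓ)) = a_f(ℓ) conj (χ(ℓ))` whenever `(ℓ, D) = 1`, and
`a_f(n m) = a_f(n) a_f(m)` whenever `n ≥ 1` and `m ∣ D^∞`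
(i.e. `m` divides some power of `D`). -/
structure IsHeckeBasis {k : ℤ} {D : ℕ} {χ : DirichletCharacter ℂ D} {ι : Type*}
    (B : Module.Basis ι ℂ (cuspSpace k χ)) : Prop where
  orthogonal : ∀ i j, i ≠ j → peterssonInner k D (B i).1 (B j).1 = 0
  conj_coeff : ∀ i, ∀ l : ℕ, 1 ≤ l → l.Coprime D →
    conj (coeffA k (B i).1 l) = coeffA k (B i).1 l * conj (χ (l : ZMod D))
  coeff_mul : ∀ i, ∀ n m : ℕ, 1 ≤ n → (∃ j : ℕ, m ∣ D ^ j) →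
    coeffA k (B i).1 (n * m) = coeffA k (B i).1 n * coeffA k (B i).1 m

/-- `L` is an entire continuation of the Dirichlet series `∑_{n ≥ 1} a(n) n^(-s)`: it is entire,
and the series converges absolutely to `L s` when `Re s` is sufficiently large. -/
def IsEntireContinuation (a : ℕ → ℂ) (L : ℂ → ℂ) : Prop :=
  Differentiable ℂ L ∧ ∃ σ₀ : ℝ, ∀ s : ℂ, σ₀ < s.re → LSeriesHasSum a s (L s)

/-- The normalized Gauss sum `ε_χ = D^(-1/2) ∑_{α mod D} χ(α) e(α / D)`. -/
def gaussEps {D : ℕ} [NeZero D] (χ : DirichletCharacter ℂ D) : ℂ :=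
  (∑ α : ZMod D, χ α * Complex.exp (2 * Real.pi * Complex.I * (α.val : ℂ) / (D : ℂ))) /
    (Real.sqrt D : ℂ)

/-- The gamma factor `γ_k(s) = c_k (2π)^(-s) Γ(s + (k-1)/2)` with `c_k = 2^((3-k)/2) √π`. -/
def gammaK (k : ℤ) (s : ℂ) : ℂ :=
  ((2 : ℂ) ^ ((3 - (k : ℂ)) / 2) * (Real.sqrt Real.pi : ℂ)) *
    (2 * Real.pi : ℂ) ^ (-s) * Complex.Gamma (s + ((k : ℂ) - 1) / 2)

/-- The second expression of the gamma factor,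
`γ_k(s) = π^(-s) Γ((s + (k-1)/2)/2) Γ((s + (k+1)/2)/2)`. -/
theorem gammaK_eq (k : ℤ) (s : ℂ) :
    gammaK k s = (Real.pi : ℂ) ^ (-s) * Complex.Gamma ((s + ((k : ℂ) - 1) / 2) / 2) *
      Complex.Gamma ((s + ((k : ℂ) + 1) / 2) / 2) := by
  have h := Complex.Gamma_mul_Gamma_add_half ((s + ((k : ℂ) - 1) / 2) / 2)
  have e1 : (s + ((k : ℂ) - 1) / 2) / 2 + 1 / 2 = (s + ((k : ℂ) + 1) / 2) / 2 := by ring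
  have e2 : 2 * ((s + ((k : ℂ) - 1) / 2) / 2) = s + ((k : ℂ) - 1) / 2 := by ring
  rw [e1, e2] at h
  have e3 : (2 * Real.pi : ℂ) ^ (-s) = (2 : ℂ) ^ (-s) * (Real.pi : ℂ) ^ (-s) := by
    have := Complex.mul_cpow_ofReal_nonneg (a := 2) (b := Real.pi) (by norm_num)
      Real.pi_pos.le (-s)
    simpa using this
  have e4 : (2 : ℂ) ^ (1 - (s + ((k : ℂ) - 1) / 2)) =
      (2 : ℂ) ^ ((3 - (k : ℂ)) / 2) * (2 : ℂ) ^ (-s) := by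
    rw [← Complex.cpow_add _ _ two_ne_zero]
    congr 1
    ring
  rw [mul_assoc, h, e4, gammaK, e3]
  ring

end HeckeFE

end

/-!
# Functional equation of the `L`-series attached to a Hecke basis of `S_k(D, χ)`

Let `f = ∑ A(n) e(nz)` be a member of the basis, `fᶜ(z) = conj (f (-conj z)) = ∑ conj A(n) e(nz)`,
and let `h(z) = z^(-k) fᶜ(-1/(Dz))`, which transforms under `Γ₀(D)` with character `χ` like `f`.
Everything follows from the proportionality `D A(D) f = τ(χ) h`
(`mul_apply_eq_gaussSum_mul_fricke`). Neither multiplicity one, nor the orthogonality of the basis,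
nor any holomorphy or Fourier expansion of `h` is needed for it. It combines two facts.

* Multiplicativity along divisors of `D` says `U_m f = A(m) f` for `m ∣ D`, and likewise for `fᶜ`.
  As `χ` is primitive, the operator `U_m` composed with its conjugate by the Fricke involution is
  a scalar on functions with nebentypus: it is a sum over the matrices `S T^(D'α) S T^β`, in which
  all terms with `D'α ≢ 0` modulo `D` cancel against a character sum
  (`HasNebentypus.sum_sum_slashSTST`). Hence `conj A(m) ∑_β h((z + β)/m) = m^k h(z)`
  (`mul_sum_fricke`).
* The relation between `conj A(l)` and `A(l)` for `l` coprime to `D` says that the twist of `f` by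
  `conj χ` equals the part of `fᶜ` supported on exponents coprime to `D`. The former is a sum of
  translates `f(z + α/D)`, the latter is `∑_{m ∣ D} μ(m) conj A(m) fᶜ(mz)`
  (`HasFourierExpansion.sum_twist`). At `-1/(Dz)` this becomes a relation between the translates
  `f((z - d)/D)`, `d` a unit modulo `D`, and the functions `h(z/m)`, `m ∣ D`
  (`sum_units_apply_div`).

Averaging the second relation over `z + j` with `j` modulo `D` and inserting the first gives
`φ(D) D A(D) f = τ(χ) ∑_{m ∣ D} μ(m) (D/m) h = φ(D) τ(χ) h`. Comparing the `U_D`-eigenvalues of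
`f` and `h` then yields `|A(D)|² = D^(k-1)`, so that `f(-1/(Dz)) = τ(χ) conj A(D) (-z)^k fᶜ(z)`
(`apply_neg_one_div`), and a Mellin transform finishes the proof.
-/

namespace HeckeFE

open Finset

/-! ### Nebentypus functions on the upper half-plane -/

/-- A function `F` on the upper half-plane, viewed as a function on `ℂ`, that transforms under
`Γ₀(D)` with weight `k` and character `χ`. No holomorphy is required. -/
def HasNebentypus (k : ℤ) {D : ℕ} (χ : DirichletCharacter ℂ D) (F : ℂ → ℂ) : Prop :=
  ∀ a b c d : ℤ, a * d - b * c = 1 → (D : ℤ) ∣ c → ∀ z : ℂ, 0 < z.im →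
    F ((a * z + b) / (c * z + d)) = χ (d : ZMod D) * (c * z + d) ^ k * F z

/-- The function `z ↦ conj (F (-conj z))`, whose Fourier coefficients are the complex conjugates
of those of `F`. -/
def conjFun (F : ℂ → ℂ) (z : ℂ) : ℂ := conj (F (-conj z))

/-- The unnormalized Fricke transform `z ↦ z^(-k) F(-1/(Dz))`. -/
noncomputable def fricke (k : ℤ) (D : ℕ) (F : ℂ → ℂ) (z : ℂ) : ℂ := z ^ (-k) * F (-1 / (D * z))

lemma ne_zero_of_im_pos {z : ℂ} (hz : 0 < z.im) : z ≠ 0 := by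
  rintro rfl
  simp at hz

lemma linear_ne_zero_of_im_pos {c d : ℤ} (h : c ≠ 0 ∨ d ≠ 0) {z : ℂ} (hz : 0 < z.im) :
    (c * z + d : ℂ) ≠ 0 := by
  intro h0
  have him := congrArg Complex.im h0
  simp [hz.ne'] at him
  subst him
  simp at h0
  tauto

lemma im_moebius_pos {a b c d : ℤ} (h : 0 < a * d - b * c) {z : ℂ} (hz : 0 < z.im) :
    0 < ((a * z + b) / (c * z + d) : ℂ).im := by
  have hne : (c * z + d : ℂ) ≠ 0 := by
    apply linear_ne_zero_of_im_pos _ hz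
    by_contra! h'
    simp [h'.1, h'.2] at h
  have hN : 0 < Complex.normSq (c * z + d) := Complex.normSq_pos.mpr hne
  have h' : (0 : ℝ) < a * d - b * c := by exact_mod_cast h
  rw [Complex.div_im, ← sub_div]
  apply div_pos _ hN
  simp only [Complex.add_im, Complex.mul_im, Complex.intCast_re, Complex.intCast_im, zero_mul,
    add_zero, Complex.add_re, Complex.mul_re, sub_zero]
  nlinarith [mul_pos h' hz]

lemma im_neg_one_div_pos {D : ℕ} [NeZero D] {z : ℂ} (hz : 0 < z.im) :
    0 < (-1 / (D * z) : ℂ).im := by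
  have := im_moebius_pos (a := 0) (b := -1) (c := D) (d := 0) (by simp [NeZero.pos D]) hz
  simpa using this

lemma im_add_int_div_pos {m : ℕ} [NeZero m] (b : ℤ) {z : ℂ} (hz : 0 < z.im) :
    0 < ((z + b) / m : ℂ).im := by
  have := im_moebius_pos (a := 1) (b := b) (c := 0) (d := m) (by simp [NeZero.pos m]) hz
  simpa using this

lemma HasNebentypus.add_int {k : ℤ} {D : ℕ} {χ : DirichletCharacter ℂ D} {F : ℂ → ℂ}
    (hF : HasNebentypus k χ F) (j : ℤ) {z : ℂ} (hz : 0 < z.im) : F (z + j) = F z := by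
  simpa using hF 1 j 0 1 (by simp) (dvd_zero _) z hz

lemma hasNebentypus_conjFun {k : ℤ} {D : ℕ} {χ : DirichletCharacter ℂ D} {F : ℂ → ℂ}
    (hF : HasNebentypus k χ F) : HasNebentypus k χ⁻¹ (conjFun F) := by
  intro a b c d hdet hc z hz
  have := hF a (-b) (-c) d (by linarith) (by simpa using hc) (-conj z) (by simpa using hz)
  rw [conjFun, conjFun, ← MulChar.star_apply']
  have e : -conj ((a * z + b) / (c * z + d) : ℂ) =
      (a * (-conj z) + (-b : ℤ)) / ((-c : ℤ) * (-conj z) + d) := by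
    simp [neg_div']
    ring_nf
  rw [e, this]
  simp

lemma fricke_apply_fricke_point (k : ℤ) (D : ℕ) [NeZero D] (F : ℂ → ℂ) {z : ℂ}
    (hz : 0 < z.im) : F z = (-D * z) ^ (-k) * fricke k D F (-1 / (D * z)) := by
  have h0 := ne_zero_of_im_pos hz
  have hD : (D : ℂ) ≠ 0 := NeZero.ne _
  have e : -1 / (D * (-1 / (D * z))) = z := by field_simp
  have e2 : (-D * z : ℂ) = (-1 / (D * z))⁻¹ := by field_simp
  rw [fricke, e, e2, inv_zpow, ← mul_assoc, zpow_neg, inv_inv, mul_inv_cancel₀, one_mul]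
  apply zpow_ne_zero
  simp [h0, hD]

lemma hasNebentypus_fricke {k : ℤ} {D : ℕ} [NeZero D] {χ : DirichletCharacter ℂ D} {F : ℂ → ℂ}
    (hF : HasNebentypus k χ⁻¹ F) : HasNebentypus k χ (fricke k D F) := by
  intro a b c d hdet hc z hz
  obtain ⟨c', rfl⟩ := hc
  have hz0 := ne_zero_of_im_pos hz
  have hD : (D : ℂ) ≠ 0 := NeZero.ne _
  have h1 : ((D * c' : ℤ) * z + d : ℂ) ≠ 0 := by
    apply linear_ne_zero_of_im_pos _ hz
    by_contra! h'
    simp [h'.1, h'.2] at hdet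
  have h2 : (a * z + b : ℂ) ≠ 0 := by
    apply linear_ne_zero_of_im_pos _ hz
    by_contra! h'
    simp [h'.1, h'.2] at hdet
  have h3 : (((-b * D : ℤ) : ℂ) * (-1 / (D * z)) + a : ℂ) = (a * z + b) / z := by
    push_cast
    field_simp
    ring
  have key := hF d (-c') (-b * D) a (by linarith) (Dvd.intro_left _ rfl) (-1 / (D * z))
    (im_neg_one_div_pos hz)
  have e : (d * (-1 / (D * z)) + (-c' : ℤ)) / ((-b * D : ℤ) * (-1 / (D * z)) + a : ℂ) =
      -1 / (D * ((a * z + b) / ((D * c' : ℤ) * z + d))) := by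
    rw [h3]
    push_cast at h1 ⊢
    field_simp
    ring
  have hχ : χ⁻¹ (a : ZMod D) = χ (d : ZMod D) := by
    have had : (a : ZMod D) * d = 1 := by
      have := congrArg (Int.cast : ℤ → ZMod D) hdet
      simpa using this
    rw [MulChar.inv_apply_eq_inv']
    apply inv_eq_of_mul_eq_one_right
    rw [← map_mul, had, map_one]
  rw [e, hχ, h3] at key
  rw [fricke, fricke, key, div_zpow, div_zpow, zpow_neg, zpow_neg, zpow_neg]
  have := zpow_ne_zero k h1
  have := zpow_ne_zero k h2
  have := zpow_ne_zero k hz0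
  field_simp

/-- For `α d ≡ 1` modulo `D`, the translate of `F` by `α / D` at the point `-1/(Dz)` is again
a rational translate of `F`; the matrix carrying `(z - d)/D` to `α/D - 1/(Dz)` is
`(α, b; D, d) ∈ Γ₀(D)`. -/
lemma HasNebentypus.apply_add_div {k : ℤ} {D : ℕ} [NeZero D] {χ : DirichletCharacter ℂ D}
    {F : ℂ → ℂ} (hF : HasNebentypus k χ F) {α d : ℤ} (h : ((α * d : ℤ) : ZMod D) = 1) {z : ℂ}
    (hz : 0 < z.im) :
    F (-1 / (D * z) + α / D) = χ (d : ZMod D) * z ^ k * F ((z + (-d : ℤ)) / D) := by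
  have hz0 := ne_zero_of_im_pos hz
  have hD : (D : ℂ) ≠ 0 := NeZero.ne _
  obtain ⟨b, hb⟩ : (D : ℤ) ∣ α * d - 1 := by
    rw [← ZMod.intCast_zmod_eq_zero_iff_dvd]
    push_cast at h ⊢
    rw [h, sub_self]
  have hb' : (α * d - 1 : ℂ) = D * b := by exact_mod_cast hb
  have key := hF α b D d (by linarith) dvd_rfl _ (im_add_int_div_pos (m := D) (-d) hz)
  have e1 : ((D : ℤ) * ((z + (-d : ℤ)) / D) + d : ℂ) = z := by
    push_cast
    field_simp
    ring
  have e2 : (α * ((z + (-d : ℤ)) / D) + b : ℂ) / z = -1 / (D * z) + α / D := by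
    push_cast
    field_simp
    linear_combination -hb'
  rw [e1, e2] at key
  exact key

/-! ### The double unipotent average -/

/-- The value at `z` of `G ∣ S T^A S T^B`, where `S T^A S T^B = (-1, -B; A, AB - 1)`. -/
noncomputable def slashSTST (k : ℤ) (G : ℂ → ℂ) (z : ℂ) (A B : ℤ) : ℂ :=
  (A * (z + B) - 1) ^ (-k) * G (-(z + B) / (A * (z + B) - 1))

/-- `G ∣ γ` depends only on the bottom row of `γ` modulo `D`, and is multiplied by `χ u` when
that row is multiplied by `u`. -/
lemma HasNebentypus.slashSTST_eq {k : ℤ} {D : ℕ} {χ : DirichletCharacter ℂ D}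
    {G : ℂ → ℂ} (hG : HasNebentypus k χ G) {A B A' B' u : ℤ} (h1 : (D : ℤ) ∣ A' - u * A)
    (h2 : (D : ℤ) ∣ (A' * B' - 1) - u * (A * B - 1)) {z : ℂ} (hz : 0 < z.im) :
    slashSTST k G z A' B' = χ (u : ZMod D) * slashSTST k G z A B := by
  have hne (A B : ℤ) : (A * (z + B) - 1 : ℂ) ≠ 0 := by
    have := linear_ne_zero_of_im_pos (c := A) (d := A * B - 1) (by
      by_contra! h'
      simp [h'.1] at h') hz
    push_cast at this
    convert this using 1
    ring
  have hw : 0 < (-(z + B) / (A * (z + B) - 1) : ℂ).im := by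
    have := im_moebius_pos (a := -1) (b := -B) (c := A) (d := A * B - 1) (by ring_nf; simp) hz
    convert this using 3 <;> push_cast <;> ring
  have hu : ((A' * B - (A' * B' - 1) : ℤ) : ZMod D) = u := by
    rw [← sub_eq_zero, ← Int.cast_sub, ZMod.intCast_zmod_eq_zero_iff_dvd]
    obtain ⟨x, hx⟩ := h1
    obtain ⟨y, hy⟩ := h2
    exact ⟨B * x - y, by linear_combination B * hx - hy⟩
  -- the entries of `(S T^A' S T^B') (S T^A S T^B)⁻¹`
  have key := hG (-(A * B - 1) + B' * A) (-B + B') (A' * (A * B - 1) - (A' * B' - 1) * A)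
    (A' * B - (A' * B' - 1)) (by ring) (by
      obtain ⟨x, hx⟩ := h1
      obtain ⟨y, hy⟩ := h2
      exact ⟨x * (A * B - 1) - y * A, by linear_combination (A * B - 1) * hx - A * hy⟩) _ hw
  have h3 := hne A B
  have h4 := hne A' B'
  have e1 : (((A' * (A * B - 1) - (A' * B' - 1) * A : ℤ) : ℂ) *
      (-(z + B) / (A * (z + B) - 1)) + (A' * B - (A' * B' - 1) : ℤ) : ℂ) =
      (A' * (z + B') - 1) / (A * (z + B) - 1) := by
    push_cast
    field_simp
    ring
  have e2 : (((-(A * B - 1) + B' * A : ℤ) : ℂ) *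
      (-(z + B) / (A * (z + B) - 1)) + (-B + B' : ℤ) : ℂ) =
      -(z + B') / (A * (z + B) - 1) := by
    push_cast
    field_simp
    ring
  rw [e1, e2, hu, div_div_div_cancel_right₀ h3] at key
  rw [slashSTST, slashSTST, key, div_zpow, zpow_neg, zpow_neg]
  have := zpow_ne_zero k h3
  have := zpow_ne_zero k h4
  field_simp

lemma dvd_val_sub {m : ℕ} [NeZero m] {x : ZMod m} {j : ℤ} (h : x = j) :
    (m : ℤ) ∣ (x.val : ℤ) - j := by
  rw [← ZMod.intCast_zmod_eq_zero_iff_dvd]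
  simp [h]

lemma coe_unitsMap_eq_val {m D : ℕ} [NeZero D] (hm : m ∣ D) (u : (ZMod D)ˣ) :
    ((ZMod.unitsMap hm u : (ZMod m)ˣ) : ZMod m) = (u.val.val : ℕ) := by
  simp [ZMod.unitsMap_def]

lemma gcd_val_unitsMap_mul {m D : ℕ} [NeZero D] [NeZero m] (hm : m ∣ D) (u : (ZMod D)ˣ)
    (α : ZMod m) : (((ZMod.unitsMap hm u : (ZMod m)ˣ) : ZMod m) * α).val.gcd m = α.val.gcd m := by
  have h : (((ZMod.unitsMap hm u : (ZMod m)ˣ) : ZMod m) * α).val = u.val.val * α.val % m := by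
    rw [coe_unitsMap_eq_val, ← ZMod.val_natCast]
    simp
  rw [h, ← Nat.gcd_rec, Nat.gcd_comm]
  exact Nat.Coprime.gcd_mul_left_cancel _ ((ZMod.val_coe_unit_coprime u).coprime_dvd_right hm)

/-- Multiplying `α` by a unit `u ≡ 1` modulo `gcd (D' α, D)` multiplies the inner sum of the
double average by `χ u`. -/
lemma HasNebentypus.sum_slashSTST_unit_mul {k : ℤ} {D' m D : ℕ} [NeZero D] [NeZero m]
    (hD : D' * m = D)
    {χ : DirichletCharacter ℂ D} {G : ℂ → ℂ} (hG : HasNebentypus k χ G) {z : ℂ} (hz : 0 < z.im)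
    (u : (ZMod D)ˣ) (α : ZMod m)
    (hu : ((D' * α.val.gcd m : ℕ) : ℤ) ∣ (u.val.val : ℤ) - 1) :
    ∑ β : ZMod m, slashSTST k G z (D' * ((ZMod.unitsMap (Dvd.intro_left D' hD) u).val * α).val)
      β.val = χ u * ∑ β : ZMod m, slashSTST k G z (D' * α.val) β.val := by
  set U : ℕ := u.val.val with hU
  set α' : ZMod m := (ZMod.unitsMap (Dvd.intro_left D' hD) u).val * α with hα'
  obtain ⟨x, hx⟩ : (m : ℤ) ∣ (α'.val : ℤ) - (U * α.val : ℤ) :=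
    dvd_val_sub (by rw [hα', coe_unitsMap_eq_val]; push_cast; simp [hU])
  have hgcd : (Int.gcd (D' * α'.val : ℤ) D : ℤ) ∣ 1 - U := by
    have : Int.gcd (D' * α'.val : ℤ) D = D' * α.val.gcd m := by
      rw [← gcd_val_unitsMap_mul (Dvd.intro_left D' hD) u α, ← Nat.gcd_mul_left, hD, ← hα']
      norm_cast
    rw [this, dvd_sub_comm]
    exact hu
  obtain ⟨t, y, ht⟩ : ∃ t y : ℤ, 1 - (U : ℤ) = D' * α'.val * t + D * y := by
    obtain ⟨q, hq⟩ := hgcd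
    rw [hq, Int.gcd_eq_gcd_ab]
    exact ⟨Int.gcdA (D' * α'.val) D * q, Int.gcdB (D' * α'.val) D * q, by ring⟩
  -- with this choice of `t`, replacing `β` by `β + t` multiplies the bottom row by `u`
  rw [mul_sum, ← Equiv.sum_comp (Equiv.addRight (t : ZMod m))]
  refine sum_congr rfl fun β _ ↦ ?_
  have hχ : χ u = χ ((U : ℤ) : ZMod D) := by simp [hU]
  have hD' : (D' * m : ℤ) = D := by exact_mod_cast hD
  obtain ⟨e, he⟩ : (m : ℤ) ∣ ((β + t).val : ℤ) - (β.val + t : ℤ) := dvd_val_sub (by simp)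
  rw [hχ, Equiv.coe_addRight]
  refine hG.slashSTST_eq ⟨x, ?_⟩ ⟨x * β.val - y + α'.val * e, ?_⟩ hz
  · linear_combination D' * hx + x * hD'
  · linear_combination D' * α'.val * he - ht + D' * β.val * hx + (x * β.val + α'.val * e) * hD'

/-- For a primitive character only the terms with `α ≡ 0` contribute to the double average:
the terms with a given `gcd (D' α, D) = e < D` are permuted by a unit `u ≡ 1` modulo `e` with
`χ u ≠ 1`. This expresses that `U_m` is, up to a scalar, unitary on nebentypus functions. -/
lemma HasNebentypus.sum_sum_slashSTST {k : ℤ} {D' m D : ℕ} [NeZero D] [NeZero m]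
    (hD : D' * m = D) {χ : DirichletCharacter ℂ D} (hχ : χ.IsPrimitive) {G : ℂ → ℂ}
    (hG : HasNebentypus k χ G) {z : ℂ} (hz : 0 < z.im) :
    ∑ α : ZMod m, ∑ β : ZMod m, slashSTST k G z (D' * α.val) β.val = m * (χ (-1) * G z) := by
  have hm : m ∣ D := Dvd.intro_left D' hD
  have hm0 : m ≠ 0 := NeZero.ne m
  have hD0 : D ≠ 0 := NeZero.ne D
  have hD'0 : 0 < D' := by
    rcases Nat.eq_zero_or_pos D' with rfl | h
    · exact absurd hD.symm (by simpa using hD0)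
    · exact h
  have hzero (β : ZMod m) :
      slashSTST k G z (D' * (0 : ZMod m).val) β.val = χ (-1) * G z := by
    have h := hG.slashSTST_eq (A := D) (A' := 0) (B := 0) (B' := β.val) (u := 1) (by simp)
      (by simp) hz
    have h' := hG (-1) 0 D (-1) (by simp) dvd_rfl z hz
    have hne : (D * z + -1 : ℂ) ≠ 0 := by
      simpa using linear_ne_zero_of_im_pos (c := D) (d := -1) (by simp) hz
    simp only [slashSTST, Int.cast_zero, add_zero, Int.cast_natCast, Int.cast_one, map_one,
      one_mul] at h
    simp only [ZMod.val_zero, Nat.cast_zero, mul_zero]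
    rw [slashSTST]
    simp only [Int.cast_zero, zero_mul, zero_sub, Int.cast_natCast]
    simp only [zero_mul, zero_sub] at h
    rw [h]
    simp only [Int.cast_neg, Int.cast_one, Int.cast_zero, add_zero, Int.cast_natCast,
      neg_one_mul] at h'
    rw [sub_eq_add_neg, h', zpow_neg]
    have := zpow_ne_zero k hne
    field_simp
  rw [← sum_fiberwise_of_maps_to (t := m.divisors) (g := fun α : ZMod m ↦ α.val.gcd m)
    (fun α _ ↦ by simp [Nat.gcd_dvd_right, hm0]), sum_eq_single m]
  · have : (univ.filter fun α : ZMod m ↦ α.val.gcd m = m) = {0} := by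
      ext α
      simp only [mem_filter, mem_univ, true_and, mem_singleton, Nat.gcd_eq_right_iff_dvd]
      constructor
      · intro h
        rw [← ZMod.val_eq_zero]
        exact Nat.eq_zero_of_dvd_of_lt h (ZMod.val_lt α)
      · rintro rfl
        simp
    rw [this, sum_singleton, sum_congr rfl fun β _ ↦ hzero β]
    simp
  · intro g hg hgm
    have hgd : g ∣ m := Nat.dvd_of_mem_divisors hg
    have hgD : D' * g ∣ D := hD ▸ Nat.mul_dvd_mul_left D' hgd
    obtain ⟨u, hu, hχu⟩ : ∃ u : (ZMod D)ˣ, ZMod.unitsMap hgD u = 1 ∧ χ u ≠ 1 := by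
      by_contra! hcon
      have hf : χ.FactorsThrough (D' * g) := by
        rw [DirichletCharacter.factorsThrough_iff_ker_unitsMap hgD]
        intro u hu
        ext
        simpa using hcon u hu
      have h1 : χ.conductor ≤ D' * g := Nat.sInf_le hf
      rw [hχ, ← hD] at h1
      exact hgm (le_antisymm (Nat.le_of_dvd (Nat.pos_of_ne_zero hm0) hgd)
        (Nat.le_of_mul_le_mul_left h1 hD'0))
    have hU : ((D' * g : ℕ) : ℤ) ∣ (u.val.val : ℤ) - 1 := by
      have : NeZero (D' * g) := ⟨fun h ↦ hD0 (Nat.eq_zero_of_zero_dvd (h ▸ hgD))⟩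
      rw [← ZMod.intCast_zmod_eq_zero_iff_dvd]
      have := coe_unitsMap_eq_val hgD u
      rw [hu] at this
      push_cast at this ⊢
      simp [← this]
    set H : ZMod m → ℂ := fun α ↦ ∑ β : ZMod m, slashSTST k G z (D' * α.val) β.val with hH
    set S := ∑ α : ZMod m with α.val.gcd m = g, H α with hS
    have hSu : S = χ u * S := by
      calc S = ∑ α : ZMod m with α.val.gcd m = g, H ((ZMod.unitsMap hm u).val * α) := by
            rw [hS, sum_filter, sum_filter,
              ← Equiv.sum_comp (Units.mulLeft (ZMod.unitsMap hm u))]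
            refine sum_congr rfl fun α _ ↦ ?_
            rw [Units.mulLeft_apply, gcd_val_unitsMap_mul]
        _ = χ u * S := by
            rw [hS, mul_sum]
            refine sum_congr rfl fun α hα ↦ ?_
            rw [mem_filter] at hα
            exact hG.sum_slashSTST_unit_mul hD hz u α (by rw [hα.2]; exact hU)
    have : (1 - χ u) * S = 0 := by linear_combination hSu
    rcases mul_eq_zero.mp this with h | h
    · exact absurd (sub_eq_zero.mp h).symm hχu
    · exact h
  · intro h
    simp [hm0] at h

/-! ### Hecke operators and twists on Fourier expansions -/

/-- `F z = ∑ A(n) e(nz)` on the upper half-plane. -/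
def HasFourierExpansion (A : ℕ → ℂ) (F : ℂ → ℂ) : Prop :=
  ∀ z : ℂ, 0 < z.im → HasSum (fun n ↦ A n * Complex.exp (2 * Real.pi * Complex.I * n * z)) (F z)

lemma hasFourierExpansion_conjFun {A : ℕ → ℂ} {F : ℂ → ℂ} (hF : HasFourierExpansion A F) :
    HasFourierExpansion (fun n ↦ conj (A n)) (conjFun F) := by
  intro z hz
  have h := (Complex.hasSum_conj'.mpr (hF (-conj z) (by simpa using hz)))
  refine h.congr_fun fun n ↦ ?_
  rw [map_mul, ← Complex.exp_conj]
  simp [Complex.conj_ofNat]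

lemma exp_add_div {m : ℕ} [NeZero m] (n : ℕ) (z : ℂ) (j : ℤ) :
    Complex.exp (2 * Real.pi * Complex.I * n * (z + j / m)) =
      Complex.exp (2 * Real.pi * Complex.I * n * z) * ZMod.stdAddChar ((n * j : ℤ) : ZMod m) := by
  rw [ZMod.stdAddChar_coe, ← Complex.exp_add]
  congr 1
  push_cast
  ring

lemma hasSum_sum_translates {m : ℕ} [NeZero m] {A : ℕ → ℂ} {F : ℂ → ℂ}
    (hF : HasFourierExpansion A F) (w : ZMod m → ℂ) {z : ℂ} (hz : 0 < z.im) :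
    HasSum (fun n : ℕ ↦ (∑ α : ZMod m, w α * ZMod.stdAddChar ((n : ZMod m) * α)) *
      (A n * Complex.exp (2 * Real.pi * Complex.I * n * z)))
      (∑ α : ZMod m, w α * F (z + α.val / m)) := by
  have (α : ZMod m) : HasSum (fun n : ℕ ↦ (w α * ZMod.stdAddChar ((n : ZMod m) * α)) *
      (A n * Complex.exp (2 * Real.pi * Complex.I * n * z))) (w α * F (z + α.val / m)) := by
    have him : 0 < (z + α.val / m).im := by
      have : (α.val / m : ℂ) = ((α.val / m : ℝ) : ℂ) := by push_cast; rfl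
      rwa [this, Complex.add_im, Complex.ofReal_im, add_zero]
    refine ((hF _ him).mul_left (w α)).congr_fun fun n ↦ ?_
    have := exp_add_div (m := m) n z α.val
    simp only [Int.cast_natCast] at this
    rw [this]
    simp
    ring
  simpa only [sum_mul] using hasSum_sum fun α _ ↦ this α

/-- The operator `U_m` acts on a Fourier series whose coefficients are multiplicative along
`m` by the scalar `A m`. -/
lemma HasFourierExpansion.sum_div {m : ℕ} [NeZero m] {A : ℕ → ℂ} {F : ℂ → ℂ}
    (hF : HasFourierExpansion A F) (hA : ∀ n, A (m * n) = A m * A n) {z : ℂ} (hz : 0 < z.im) :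
    ∑ α : ZMod m, F ((z + α.val) / m) = m * A m * F z := by
  have hm : (m : ℂ) ≠ 0 := NeZero.ne _
  have hz' : 0 < (z / m).im := by
    have := im_add_int_div_pos (m := m) 0 hz
    simpa using this
  have h := hasSum_sum_translates hF (fun _ : ZMod m ↦ 1) hz'
  have hinj : Function.Injective (fun n : ℕ ↦ m * n) :=
    fun a b hab ↦ Nat.eq_of_mul_eq_mul_left (NeZero.pos m) hab
  simp only [one_mul, ← add_div] at h
  rw [← hinj.hasSum_iff] at h
  · refine h.unique (((hF z hz).mul_left (m * A m)).congr_fun fun n ↦ ?_)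
    simp only [Function.comp_apply, hA]
    have : Complex.exp (2 * Real.pi * Complex.I * (m * n : ℕ) * (z / m)) =
        Complex.exp (2 * Real.pi * Complex.I * n * z) := by
      congr 1
      push_cast
      field_simp
    rw [this]
    simp
    ring
  · intro n hn
    have hn' : (n : ZMod m) ≠ 0 := by
      rw [Ne, ZMod.natCast_eq_zero_iff]
      rintro ⟨q, rfl⟩
      exact hn ⟨q, rfl⟩
    have := AddChar.sum_mulShift (n : ZMod m) (ZMod.isPrimitive_stdAddChar m)
    simp only [mul_comm] at this ⊢
    rw [this]
    simp [hn']

lemma sum_moebius_dvd_dvd (n D : ℕ) (hD : D ≠ 0) :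
    ∑ m ∈ D.divisors, (if m ∣ n then (ArithmeticFunction.moebius m : ℂ) else 0) =
      if n.Coprime D then 1 else 0 := by
  have hg : n.gcd D ≠ 0 := fun h ↦ hD (Nat.eq_zero_of_gcd_eq_zero_right h)
  have h := congrArg (fun f : ArithmeticFunction ℤ ↦ f (n.gcd D))
    ArithmeticFunction.moebius_mul_coe_zeta
  simp only [ArithmeticFunction.coe_mul_zeta_apply, ArithmeticFunction.one_apply] at h
  rw [← sum_filter]
  have : D.divisors.filter (· ∣ n) = (n.gcd D).divisors := by
    ext m
    simp [Nat.dvd_gcd_iff, hD, hg]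
    tauto
  rw [this]
  exact_mod_cast h

/-- The twist of `F` by the primitive character `χ`, written once as a sum of translates via the
Gauss sum, and once, using the relation between `A` and `conj A`, as the part of `conjFun F`
supported on exponents coprime to `D`. -/
lemma HasFourierExpansion.sum_twist {D : ℕ} [NeZero D] {A : ℕ → ℂ} {F : ℂ → ℂ}
    (hF : HasFourierExpansion A F) {χ : DirichletCharacter ℂ D} (hχ : χ.IsPrimitive)
    (hA : ∀ m n, m ∣ D → A (m * n) = A m * A n)
    (hconj : ∀ l : ℕ, l.Coprime D → conj (A l) = χ⁻¹ l * A l) {z : ℂ} (hz : 0 < z.im) :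
    ∑ α : ZMod D, χ α * F (z + α.val / D) = gaussSum χ (ZMod.stdAddChar (N := D)) *
      ∑ m ∈ D.divisors, (ArithmeticFunction.moebius m : ℂ) * conj (A m) * conjFun F (m * z) := by
  have h1 := hasSum_sum_translates hF (fun α : ZMod D ↦ χ α) hz
  refine h1.unique ?_
  have h2 (m : ℕ) (hm : m ∈ D.divisors) :
      HasSum (fun n : ℕ ↦ (if m ∣ n then (ArithmeticFunction.moebius m : ℂ) else 0) *
        (conj (A n) * Complex.exp (2 * Real.pi * Complex.I * n * z)))
      ((ArithmeticFunction.moebius m : ℂ) * conj (A m) * conjFun F (m * z)) := by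
    have hmD := Nat.dvd_of_mem_divisors hm
    have hm0 := Nat.pos_of_mem_divisors hm
    have hinj : Function.Injective (fun n : ℕ ↦ m * n) :=
      fun a b hab ↦ Nat.eq_of_mul_eq_mul_left hm0 hab
    rw [← hinj.hasSum_iff]
    · refine ((hasFourierExpansion_conjFun hF (m * z) (by simp [hm0, hz])).mul_left
        ((ArithmeticFunction.moebius m : ℂ) * conj (A m))).congr_fun fun n ↦ ?_
      simp only [Function.comp_apply, dvd_mul_right, if_true, hA m n hmD, map_mul]
      push_cast
      ring_nf
    · intro n hn
      rw [if_neg, zero_mul]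
      rintro ⟨q, rfl⟩
      exact hn ⟨q, rfl⟩
  refine ((hasSum_sum h2).mul_left _).congr_fun fun n ↦ ?_
  rw [← sum_mul, sum_moebius_dvd_dvd n D (NeZero.ne D)]
  have hg := gaussSum_mulShift_of_isPrimitive (ZMod.stdAddChar (N := D)) hχ (n : ZMod D)
  simp only [gaussSum, AddChar.mulShift_apply] at hg
  simp only [gaussSum]
  rw [hg]
  split_ifs with hn
  · rw [hconj n hn]
    ring
  · rw [MulChar.map_nonunit _ (by rwa [ZMod.isUnit_iff_coprime])]
    simp

/-! ### The Fricke involution -/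

lemma zpow_mul_apply_translate_fricke (k : ℤ) {D' m D : ℕ} [NeZero D] [NeZero m]
    (hD : D' * m = D) (G : ℂ → ℂ) (α β : ℕ) {z : ℂ} (hz : 0 < z.im) :
    ((z + β) / m) ^ (-k) * G ((-1 / (D * ((z + β) / m)) + α) / m) =
      (-m : ℂ) ^ k * slashSTST k (fricke k D G) z (D' * α) β := by
  have hm : (m : ℂ) ≠ 0 := NeZero.ne _
  have hD0 : (D : ℂ) ≠ 0 := NeZero.ne _
  have hDc : (D' * m : ℂ) = D := by exact_mod_cast hD
  have hz' := im_add_int_div_pos (m := m) β hz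
  simp only [Int.cast_natCast] at hz'
  have hz0 : (z + β : ℂ) ≠ 0 := by
    intro h
    simp [h] at hz'
  have hv := im_add_int_div_pos (m := m) α (im_neg_one_div_pos (D := D) hz')
  simp only [Int.cast_natCast] at hv
  have hv0 := ne_zero_of_im_pos hv
  have e1 : (-D * ((-1 / (D * ((z + β) / m)) + α) / m) : ℂ) =
      -((D' * α * (z + β) - 1) / (z + β)) := by
    rw [← hDc] at hD0 ⊢
    have := left_ne_zero_of_mul hD0
    field_simp
    ring
  have hne : (D' * α * (z + β) - 1 : ℂ) ≠ 0 := by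
    intro h
    rw [h, zero_div, neg_zero] at e1
    exact mul_ne_zero (neg_ne_zero.mpr hD0) hv0 e1
  have e2 : (-1 / (D * ((-1 / (D * ((z + β) / m)) + α) / m)) : ℂ) =
      -(z + β) / (D' * α * (z + β) - 1) := by
    have : (D * ((-1 / (D * ((z + β) / m)) + α) / m) : ℂ) =
      (D' * α * (z + β) - 1) / (z + β) := by linear_combination -e1
    rw [this]
    field_simp
  rw [fricke_apply_fricke_point k D G hv, e1, e2, slashSTST]
  push_cast
  have e3 : (-((D' * α * (z + β) - 1) / (z + β)) : ℂ) =
      (-m : ℂ)⁻¹ * (D' * α * (z + β) - 1) * ((z + β) / m)⁻¹ := by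
    field_simp
  have h1 := zpow_ne_zero k hne
  have h2 := zpow_ne_zero k (div_ne_zero hz0 hm)
  have h3 := zpow_ne_zero k (neg_ne_zero.mpr hm)
  rw [e3, mul_zpow, mul_zpow, inv_zpow, inv_zpow, zpow_neg, zpow_neg, zpow_neg]
  field_simp

/-- If `U_m G = A(m) G`, then the Fricke transform of `G` is an eigenfunction of `U_m` as well. -/
lemma mul_sum_fricke {k : ℤ} {D' m D : ℕ} [NeZero D] [NeZero m]
    (hD : D' * m = D) {χ : DirichletCharacter ℂ D} (hχ : χ.IsPrimitive)
    (hχk : χ (-1) = (-1) ^ k) {G : ℂ → ℂ} (hG : HasNebentypus k χ⁻¹ G) {A : ℕ → ℂ}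
    (hGA : HasFourierExpansion A G) (hA : ∀ n, A (m * n) = A m * A n) {z : ℂ} (hz : 0 < z.im) :
    A m * ∑ β : ZMod m, fricke k D G ((z + β.val) / m) = (m : ℂ) ^ k * fricke k D G z := by
  have hm : (m : ℂ) ≠ 0 := NeZero.ne _
  have h (β : ZMod m) : m * A m * fricke k D G ((z + β.val) / m) =
      (-m : ℂ) ^ k * ∑ α : ZMod m, slashSTST k (fricke k D G) z (D' * α.val) β.val := by
    have hz' := im_add_int_div_pos (m := m) β.val hz
    rw [Int.cast_natCast] at hz'
    rw [fricke, mul_left_comm, ← hGA.sum_div hA (im_neg_one_div_pos hz'), mul_sum, mul_sum]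
    exact sum_congr rfl fun α _ ↦ zpow_mul_apply_translate_fricke k hD G α.val β.val hz
  have hsum := sum_congr (rfl : (univ : Finset (ZMod m)) = univ) fun β _ ↦ h β
  rw [← mul_sum, ← mul_sum, sum_comm, (hasNebentypus_fricke hG).sum_sum_slashSTST hD hχ hz, hχk,
    neg_eq_neg_one_mul (m : ℂ), mul_zpow] at hsum
  have h1 : ((-1 : ℂ) ^ k) * (-1) ^ k = 1 := by
    rw [← mul_zpow]
    simp
  apply mul_left_cancel₀ hm
  linear_combination hsum + (m : ℂ) ^ k * m * fricke k D G z * h1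

lemma sum_zmod_eq_sum_range {M : Type*} [AddCommMonoid M] (m : ℕ) [NeZero m] (g : ℕ → M) :
    ∑ x : ZMod m, g x.val = ∑ i ∈ range m, g i :=
  sum_nbij' ZMod.val Nat.cast (fun x _ ↦ mem_range.mpr (ZMod.val_lt x)) (by simp) (by simp)
    (fun i hi ↦ ZMod.val_cast_of_lt (mem_range.mp hi)) (by simp)

lemma sum_range_mul_of_periodic {g : ℕ → ℂ} {m : ℕ} (hg : ∀ i, g (i + m) = g i) (q : ℕ) :
    ∑ i ∈ range (q * m), g i = q * ∑ i ∈ range m, g i := by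
  have hg' (q i : ℕ) : g (q * m + i) = g i := by
    induction q with
    | zero => simp
    | succ q ih => rw [← ih, ← hg (q * m + i)]; ring_nf
  induction q with
  | zero => simp
  | succ q ih =>
    rw [add_mul, one_mul, sum_range_add, ih, sum_congr rfl fun i _ ↦ hg' q i]
    push_cast
    ring

lemma sum_moebius_mul_div (D : ℕ) [NeZero D] :
    ∑ m ∈ D.divisors, (ArithmeticFunction.moebius m : ℂ) * (D / m : ℕ) = D.totient := by
  have h := (ArithmeticFunction.sum_eq_iff_sum_mul_moebius_eq (R := ℂ)
    (f := fun n ↦ (n.totient : ℂ)) (g := fun n ↦ (n : ℂ))).mp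
    (fun n _ ↦ by exact_mod_cast n.sum_totient) D (NeZero.pos D)
  rw [← h, Nat.sum_divisorsAntidiagonal
    (fun x y : ℕ ↦ (ArithmeticFunction.moebius x : ℂ) * (y : ℂ))]

/-- The twisting identity `HasFourierExpansion.sum_twist` at the point `-1/(Dz)`. -/
lemma sum_units_apply_div {k : ℤ} {D : ℕ} [NeZero D] {χ : DirichletCharacter ℂ D}
    (hχ : χ.IsPrimitive) {F : ℂ → ℂ} (hF : HasNebentypus k χ F) {A : ℕ → ℂ}
    (hFA : HasFourierExpansion A F) (hA : ∀ m n, m ∣ D → A (m * n) = A m * A n)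
    (hconj : ∀ l : ℕ, l.Coprime D → conj (A l) = χ⁻¹ l * A l) {z : ℂ} (hz : 0 < z.im) :
    ∑ u : (ZMod D)ˣ, F ((z + (-((u⁻¹).val.val : ℤ) : ℤ)) / D) =
      gaussSum χ (ZMod.stdAddChar (N := D)) * ∑ m ∈ D.divisors,
        (ArithmeticFunction.moebius m : ℂ) * conj (A m) *
          ((m : ℂ) ^ (-k) * fricke k D (conjFun F) (z / m)) := by
  have hz0 := ne_zero_of_im_pos hz
  have hD : (D : ℂ) ≠ 0 := NeZero.ne _
  have h := hFA.sum_twist hχ hA hconj (im_neg_one_div_pos (D := D) hz)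
  have hl : ∑ u : (ZMod D)ˣ, z ^ k * F ((z + (-((u⁻¹).val.val : ℤ) : ℤ)) / D) =
      ∑ α : ZMod D, χ α * F (-1 / (D * z) + α.val / D) := by
    refine Fintype.sum_of_injective Units.val Units.val_injective _ _ (fun α hα ↦ ?_)
      (fun u ↦ ?_)
    · rw [MulChar.map_nonunit, zero_mul]
      exact fun ⟨u, hu⟩ ↦ hα ⟨u, hu⟩
    · have := hF.apply_add_div (α := u.val.val) (d := (u⁻¹).val.val) (by simp) hz
      simp only [Int.cast_natCast] at this
      rw [this, ZMod.natCast_zmod_val, ← mul_assoc, ← mul_assoc, ← map_mul, Units.mul_inv,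
        map_one, one_mul]
  rw [← hl, ← mul_sum] at h
  apply mul_left_cancel₀ (zpow_ne_zero k hz0)
  rw [h, mul_left_comm]
  congr 1
  rw [mul_sum]
  refine sum_congr rfl fun m hm ↦ ?_
  have hm0 : (m : ℂ) ≠ 0 := by exact_mod_cast (Nat.pos_of_mem_divisors hm).ne'
  have e : (-1 / (D * (z / m)) : ℂ) = m * (-1 / (D * z)) := by
    field_simp
  have := zpow_ne_zero k hz0
  have := zpow_ne_zero k hm0
  rw [fricke, e, zpow_neg, zpow_neg, div_zpow]
  field_simp

/-- The Fricke transform of `conjFun F` is a multiple of `F`. Averaging `sum_units_apply_div` over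
the translates `z + j`, `j` modulo `D`, turns the left side into `U_D F` and each term on the right
into `U_m` applied to the Fricke transform. -/
lemma mul_apply_eq_gaussSum_mul_fricke {k : ℤ} {D : ℕ} [NeZero D] {χ : DirichletCharacter ℂ D}
    (hχ : χ.IsPrimitive) (hχk : χ (-1) = (-1) ^ k) {F : ℂ → ℂ} (hF : HasNebentypus k χ F)
    {A : ℕ → ℂ}
    (hFA : HasFourierExpansion A F) (hA : ∀ m n, m ∣ D → A (m * n) = A m * A n)
    (hconj : ∀ l : ℕ, l.Coprime D → conj (A l) = χ⁻¹ l * A l) {z : ℂ} (hz : 0 < z.im) :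
    D * A D * F z =
      gaussSum χ (ZMod.stdAddChar (N := D)) * fricke k D (conjFun F) z := by
  set τ := gaussSum χ (ZMod.stdAddChar (N := D)) with hτ
  set h := fricke k D (conjFun F) with hh
  have hN : HasNebentypus k χ h := hasNebentypus_fricke (hasNebentypus_conjFun hF)
  have hL : ∑ j : ZMod D, ∑ u : (ZMod D)ˣ, F ((z + j.val + (-((u⁻¹).val.val : ℤ) : ℤ)) / D) =
      D.totient * (D * A D * F z) := by
    rw [sum_comm]
    have (u : (ZMod D)ˣ) :
        ∑ j : ZMod D, F ((z + j.val + (-((u⁻¹).val.val : ℤ) : ℤ)) / D) = D * A D * F z := by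
      set v : ℤ := -((u⁻¹).val.val : ℤ)
      have := hFA.sum_div (m := D) (fun n ↦ hA D n dvd_rfl) (z := z + v) (by simpa using hz)
      rw [hF.add_int v hz] at this
      rw [← this]
      exact sum_congr rfl fun j _ ↦ by rw [add_right_comm]
    rw [sum_congr rfl fun u _ ↦ this u]
    simp [ZMod.card_units_eq_totient]
  have hR : ∑ j : ZMod D, (τ * ∑ m ∈ D.divisors, (ArithmeticFunction.moebius m : ℂ) *
      conj (A m) * ((m : ℂ) ^ (-k) * h ((z + j.val) / m))) = τ * (D.totient * h z) := by
    rw [← mul_sum, sum_comm, ← sum_moebius_mul_div D, sum_mul]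
    congr 1
    refine sum_congr rfl fun m hm ↦ ?_
    have hmD := Nat.dvd_of_mem_divisors hm
    have : NeZero m := ⟨(Nat.pos_of_mem_divisors hm).ne'⟩
    have hm0 : (m : ℂ) ≠ 0 := NeZero.ne _
    have key := mul_sum_fricke (Nat.div_mul_cancel hmD) hχ hχk (hasNebentypus_conjFun hF)
      (hasFourierExpansion_conjFun hFA) (fun n ↦ by rw [hA m n hmD, map_mul]) hz
    have hper (i : ℕ) : h ((z + (i + m : ℕ)) / m) = h ((z + i) / m) := by
      have := hN.add_int 1 (im_add_int_div_pos (m := m) i hz)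
      rw [Int.cast_natCast, Int.cast_one] at this
      rw [← this]
      congr 1
      push_cast
      field_simp
      ring
    have hs : ∑ j : ZMod D, h ((z + j.val) / m) =
        (D / m : ℕ) * ∑ β : ZMod m, h ((z + β.val) / m) := by
      rw [sum_zmod_eq_sum_range D (fun i ↦ h ((z + i) / m)),
        sum_zmod_eq_sum_range m (fun i ↦ h ((z + i) / m)),
        ← sum_range_mul_of_periodic hper, Nat.div_mul_cancel hmD]
    rw [← mul_sum, ← mul_sum, hs]
    have := zpow_ne_zero k hm0
    rw [zpow_neg]
    field_simp
    linear_combination (ArithmeticFunction.moebius m : ℂ) * (D / m : ℕ) * key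
  have hmain := sum_congr (rfl : (univ : Finset (ZMod D)) = univ) fun j _ ↦
    sum_units_apply_div hχ hF hFA hA hconj (z := z + j.val) (by
      rw [Complex.add_im, Complex.natCast_im, add_zero]
      exact hz)
  rw [hL, hR] at hmain
  have : (D.totient : ℂ) ≠ 0 := by exact_mod_cast (Nat.totient_pos.mpr (NeZero.pos D)).ne'
  apply mul_left_cancel₀ this
  linear_combination hmain

/-- The Fricke transformation law of `F`. -/
theorem apply_neg_one_div {k : ℤ} {D : ℕ} [NeZero D] {χ : DirichletCharacter ℂ D}
    (hχ : χ.IsPrimitive) (hχk : χ (-1) = (-1) ^ k) {F : ℂ → ℂ} (hF : HasNebentypus k χ F)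
    {A : ℕ → ℂ}
    (hFA : HasFourierExpansion A F) (hA : ∀ m n, m ∣ D → A (m * n) = A m * A n)
    (hconj : ∀ l : ℕ, l.Coprime D → conj (A l) = χ⁻¹ l * A l)
    (hF0 : ∃ z : ℂ, 0 < z.im ∧ F z ≠ 0) {z : ℂ} (hz : 0 < z.im) :
    F (-1 / (D * z)) = gaussSum χ (ZMod.stdAddChar (N := D)) * conj (A D) * (-z) ^ k *
      conjFun F z := by
  set τ := gaussSum χ (ZMod.stdAddChar (N := D)) with hτ
  set h := fricke k D (conjFun F) with hh
  have hD : (D : ℂ) ≠ 0 := NeZero.ne _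
  have hM {w : ℂ} (hw : 0 < w.im) : D * A D * F w = τ * h w :=
    mul_apply_eq_gaussSum_mul_fricke hχ hχk hF hFA hA hconj hw
  have hU {w : ℂ} (hw : 0 < w.im) :
      conj (A D) * ∑ β : ZMod D, h ((w + β.val) / D) = (D : ℂ) ^ k * h w :=
    mul_sum_fricke (one_mul D) hχ hχk (hasNebentypus_conjFun hF)
      (hasFourierExpansion_conjFun hFA) (fun n ↦ by rw [hA D n dvd_rfl, map_mul]) hw
  obtain ⟨z₀, hz₀, hFz₀⟩ := hF0
  -- `A D = 0` would force `h`, hence `conjFun F` and `F`, to vanish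
  have hAD : A D ≠ 0 := by
    intro h0
    have hw : 0 < (-conj z₀).im := by simpa using hz₀
    have h1 := hU (im_neg_one_div_pos (D := D) hw)
    rw [h0, map_zero, zero_mul, zero_eq_mul] at h1
    have h2 : h (-1 / (D * -conj z₀)) = 0 := h1.resolve_left (zpow_ne_zero k hD)
    have h3 := fricke_apply_fricke_point k D (conjFun F) hw
    rw [← hh, h2, mul_zero, conjFun] at h3
    simp [hFz₀] at h3
  -- the eigenvalue of `U_D` has absolute value `D ^ ((k - 1) / 2)`
  have habs : D * (conj (A D) * A D) = (D : ℂ) ^ k := by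
    have h1 := hU hz₀
    have h2 : τ * ∑ β : ZMod D, h ((z₀ + β.val) / D) = D * A D * (D * A D * F z₀) := by
      rw [← hFA.sum_div (fun n ↦ hA D n dvd_rfl) hz₀, mul_sum, mul_sum]
      refine sum_congr rfl fun β _ ↦ (hM ?_).symm
      simpa using im_add_int_div_pos (m := D) β.val hz₀
    apply mul_right_cancel₀ (mul_ne_zero (mul_ne_zero hD hAD) hFz₀)
    linear_combination τ * h1 - conj (A D) * h2 - (D : ℂ) ^ k * hM hz₀
  have h1 := hM (im_neg_one_div_pos (D := D) hz)
  have h2 := fricke_apply_fricke_point k D (conjFun F) hz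
  have hz0 := ne_zero_of_im_pos hz
  have h3 : h (-1 / (D * z)) = (D : ℂ) ^ k * (-z) ^ k * conjFun F z := by
    have e : (-D * z : ℂ) = D * (-z) := by ring
    have := zpow_ne_zero k hD
    have := zpow_ne_zero k (neg_ne_zero.mpr hz0)
    rw [h2, e, mul_zpow, zpow_neg, zpow_neg, ← hh]
    field_simp
  apply mul_left_cancel₀ (zpow_ne_zero k hD)
  rw [h3] at h1
  linear_combination conj (A D) * h1 - F (-1 / (D * z)) * habs

/-! ### Members of a Hecke basis -/

section Basis

variable {k : ℤ} {D : ℕ} {χ : DirichletCharacter ℂ D}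

lemma hasNebentypus_comp_ofComplex (f : cuspSpace k χ) :
    HasNebentypus k χ (fun z ↦ f.1 (ofComplex z)) := by
  intro a b c d hdet hc z hz
  let γ : SL(2, ℤ) := ⟨!![a, b; c, d], by rw [Matrix.det_fin_two_of, hdet]⟩
  have hγ : γ ∈ Gamma0 D := by
    rw [Gamma0_mem]
    exact (ZMod.intCast_zmod_eq_zero_iff_dvd c D).mpr hc
  have h := congrFun (f.2 ⟨γ, hγ⟩) ⟨z, hz⟩
  rw [SL_slash_apply] at h
  have hd : denom γ z = c * z + d := by
    change ((c : ℝ) : ℂ) * z + ((d : ℝ) : ℂ) = _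
    push_cast
    rfl
  have hne : (c * z + d : ℂ) ≠ 0 := hd ▸ denom_ne_zero_of_im _ hz.ne'
  have hs : γ • (⟨z, hz⟩ : ℍ) = ofComplex ((a * z + b) / (c * z + d)) := by
    ext
    rw [ofComplex_apply_of_im_pos (im_moebius_pos (by rw [hdet]; exact one_pos) hz)]
    rw [coe_specialLinearGroup_apply]
    simp [γ]
  have hχ : Gamma0Map D ⟨γ, hγ⟩ = d := by simp [Gamma0Map, γ]
  simp only [] at h
  rw [hs, hd, hχ, zpow_neg, Pi.smul_apply, smul_eq_mul] at h
  have := zpow_ne_zero k hne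
  rw [← div_eq_mul_inv, div_eq_iff this] at h
  simp only [h, ofComplex_apply_of_im_pos hz]
  ring

lemma one_mem_strictPeriods_Gamma1 (D : ℕ) :
    (1 : ℝ) ∈ ((Gamma1 D).map (Matrix.SpecialLinearGroup.mapGL ℝ)).strictPeriods := by
  simp

lemma hasFourierExpansion_comp_ofComplex [NeZero D] (f : cuspSpace k χ) :
    HasFourierExpansion (fun n ↦ (qExpansion 1 f.1).coeff n) (fun z ↦ f.1 (ofComplex z)) := by
  intro z hz
  have h := ModularForm.hasSum_qExpansion f.1 one_pos (one_mem_strictPeriods_Gamma1 D)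
    (ofComplex z)
  refine h.congr_fun fun n ↦ ?_
  rw [ofComplex_apply_of_im_pos hz, Function.Periodic.qParam, ← Complex.exp_nat_mul]
  congr 2
  simp
  ring

lemma qExpansion_coeff_zero_eq_zero (f : cuspSpace k χ) : (qExpansion 1 f.1).coeff 0 = 0 :=
  CuspFormClass.qExpansion_coeff_zero f.1 one_pos (one_mem_strictPeriods_Gamma1 D)

lemma qExpansion_coeff_eq (f : cuspSpace k χ) (n : ℕ) :
    (qExpansion 1 f.1).coeff n = coeffA k f.1 n * (n : ℂ) ^ (((k : ℂ) - 1) / 2) := by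
  rcases Nat.eq_zero_or_pos n with rfl | hn
  · simp [coeffA, qExpansion_coeff_zero_eq_zero]
  · rw [coeffA, div_mul_cancel₀]
    simp [Complex.cpow_eq_zero_iff, hn.ne']

variable {ι : Type*} {B : Module.Basis ι ℂ (cuspSpace k χ)}

lemma IsHeckeBasis.qExpansion_coeff_mul (hB : IsHeckeBasis B) (i : ι) (m n : ℕ) (hm : m ∣ D) :
    (qExpansion 1 (B i).1).coeff (m * n) =
      (qExpansion 1 (B i).1).coeff m * (qExpansion 1 (B i).1).coeff n := by
  rcases Nat.eq_zero_or_pos n with rfl | hn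
  · simp [qExpansion_coeff_zero_eq_zero]
  · rw [qExpansion_coeff_eq, qExpansion_coeff_eq, qExpansion_coeff_eq, mul_comm m n,
      hB.coeff_mul i n m hn ⟨1, by simpa using hm⟩, Nat.cast_mul,
      Complex.natCast_mul_natCast_cpow]
    ring

lemma conj_natCast_cpow (k : ℤ) (n : ℕ) :
    conj ((n : ℂ) ^ (((k : ℂ) - 1) / 2)) = (n : ℂ) ^ (((k : ℂ) - 1) / 2) := by
  have : (n : ℂ) ^ (((k : ℂ) - 1) / 2) = (((n : ℝ) ^ (((k : ℝ) - 1) / 2) : ℝ) : ℂ) := by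
    rw [Complex.ofReal_cpow n.cast_nonneg]
    push_cast
    rfl
  rw [this, Complex.conj_ofReal]

lemma IsHeckeBasis.conj_qExpansion_coeff (hB : IsHeckeBasis B) (i : ι) (l : ℕ)
    (hl : l.Coprime D) :
    conj ((qExpansion 1 (B i).1).coeff l) = χ⁻¹ l * (qExpansion 1 (B i).1).coeff l := by
  rcases Nat.eq_zero_or_pos l with rfl | hl0
  · simp [qExpansion_coeff_zero_eq_zero]
  · rw [qExpansion_coeff_eq, map_mul, hB.conj_coeff i l hl0 hl, conj_natCast_cpow,
      ← MulChar.star_apply']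
    simp only [RCLike.star_def]
    ring

lemma exists_apply_ofComplex_ne_zero (B : Module.Basis ι ℂ (cuspSpace k χ)) (i : ι) :
    ∃ z : ℂ, 0 < z.im ∧ (B i).1 (ofComplex z) ≠ 0 := by
  by_contra! h
  apply B.ne_zero i
  ext τ
  simpa using h τ τ.im_pos

end Basis

/-! ### Completed and uncompleted `L`-functions -/

lemma mellin_conj (φ : ℝ → ℂ) (s : ℂ) :
    mellin (fun t ↦ conj (φ t)) s = conj (mellin φ (conj s)) := by
  rw [mellin, mellin, ← integral_conj]
  refine MeasureTheory.setIntegral_congr_fun measurableSet_Ioi fun t ht ↦ ?_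
  have harg : (t : ℂ).arg ≠ Real.pi := by
    rw [Complex.arg_ofReal_of_nonneg (le_of_lt ht)]
    exact Real.pi_pos.ne
  have := Complex.cpow_conj (t : ℂ) (s - 1) harg
  simp only [smul_eq_mul, map_mul]
  rw [map_sub, map_one] at this
  rw [this, Complex.conj_conj, Complex.conj_ofReal]

lemma gaussSum_eq_gaussEps_mul {D : ℕ} [NeZero D] (χ : DirichletCharacter ℂ D) :
    gaussSum χ (ZMod.stdAddChar (N := D)) = gaussEps χ * (D : ℂ) ^ (1 / 2 : ℂ) := by
  have hs : ((√D : ℝ) : ℂ) = (D : ℂ) ^ (1 / 2 : ℂ) := by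
    rw [Real.sqrt_eq_rpow, Complex.ofReal_cpow D.cast_nonneg]
    push_cast
    rfl
  have h0 : (D : ℂ) ^ (1 / 2 : ℂ) ≠ 0 := by simp [Complex.cpow_eq_zero_iff, NeZero.ne]
  rw [gaussEps, hs, div_mul_cancel₀ _ h0, gaussSum]
  refine sum_congr rfl fun α _ ↦ ?_
  have := ZMod.stdAddChar_coe (N := D) α.val
  simp only [Int.cast_natCast, ZMod.natCast_zmod_val] at this
  rw [this]

/-- Functional equation of the Mellin transform of a function on the imaginary axis satisfying
a Fricke transformation law. -/
lemma mellin_functional_equation {D : ℕ} [NeZero D] {k : ℤ} {F : ℂ → ℂ} {C : ℂ}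
    (hF : ∀ z : ℂ, 0 < z.im → F (-1 / (D * z)) = C * (-z) ^ k * conjFun F z) (w : ℂ) :
    (D : ℂ) ^ w * mellin (fun t : ℝ ↦ F (Complex.I * t)) w =
      C * (-Complex.I) ^ k *
        conj (mellin (fun t : ℝ ↦ F (Complex.I * t)) (conj (k - w))) := by
  set φ : ℝ → ℂ := fun t ↦ F (Complex.I * t) with hφ
  have hD : (0 : ℝ) < D := by exact_mod_cast NeZero.pos D
  have h1 : mellin (fun t : ℝ ↦ φ (D * t)⁻¹) (-w) = (D : ℂ) ^ w * mellin φ w := by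
    rw [mellin_comp_mul_left (fun t ↦ φ t⁻¹) _ hD, mellin_comp_inv, neg_neg, smul_eq_mul,
      Complex.ofReal_natCast]
  have h2 : mellin (fun t : ℝ ↦ φ (D * t)⁻¹) (-w) =
      mellin (fun t : ℝ ↦ (C * (-Complex.I) ^ k) • ((t : ℂ) ^ (k : ℂ) • conj (φ t))) (-w) := by
    refine MeasureTheory.setIntegral_congr_fun measurableSet_Ioi fun t ht ↦ ?_
    have ht' : (0 : ℝ) < t := ht
    have ht0 : (t : ℂ) ≠ 0 := by exact_mod_cast ht'.ne'
    have hD0 : (D : ℂ) ≠ 0 := NeZero.ne _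
    have h := hF (Complex.I * t) (by simpa using ht')
    have e : (-1 / (D * (Complex.I * t)) : ℂ) = Complex.I * ((D * t)⁻¹ : ℝ) := by
      push_cast
      field_simp
      rw [Complex.I_sq]
    have e2 : (-(Complex.I * t) : ℂ) ^ k = (-Complex.I) ^ k * (t : ℂ) ^ (k : ℂ) := by
      rw [← neg_mul, mul_zpow, Complex.cpow_intCast]
    have e3 : conjFun F (Complex.I * t) = conj (φ t) := by
      simp [conjFun, hφ]
    rw [e, e2, e3] at h
    simp only [smul_eq_mul]
    congr 1
    rw [hφ]
    simp only []
    rw [h]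
    ring
  rw [← h1, h2, mellin_const_smul, mellin_cpow_smul, mellin_conj, smul_eq_mul, neg_add_eq_sub]

section CuspForm

variable {k : ℤ} {D : ℕ} [NeZero D] {χ : DirichletCharacter ℂ D}

/-- The entire continuation of the Dirichlet series of the normalized coefficients of `f`. -/
noncomputable def normalizedL (hk : 0 < k) (f : cuspSpace k χ) (s : ℂ) : ℂ :=
  ModularForm.L hk f.1 (s + ((k : ℂ) - 1) / 2)

lemma normalizedL_eq (hk : 0 < k) (f : cuspSpace k χ) (s : ℂ) :
    normalizedL hk f s = (2 : ℂ) ^ ((3 - (k : ℂ)) / 2) * (Real.sqrt Real.pi : ℂ) *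
      (2 * Real.pi : ℂ) ^ (((k : ℂ) - 1) / 2) *
      ModularForm.Λ hk f.1 (s + ((k : ℂ) - 1) / 2) * (gammaK k s)⁻¹ := by
  have hpi : (2 * Real.pi : ℂ) ≠ 0 := by simp [Real.pi_ne_zero]
  have hpi' : (Real.sqrt Real.pi : ℂ) ≠ 0 := by simp [Real.sqrt_eq_zero', Real.pi_pos]
  have h2 : (2 : ℂ) ^ ((3 - (k : ℂ)) / 2) ≠ 0 := by simp [Complex.cpow_eq_zero_iff]
  have e : (2 * Real.pi : ℂ) ^ (-s) = (2 * Real.pi : ℂ) ^ (-(s + ((k : ℂ) - 1) / 2)) *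
      (2 * Real.pi : ℂ) ^ (((k : ℂ) - 1) / 2) := by
    rw [← Complex.cpow_add _ _ hpi]
    congr 1
    ring
  have h3 : (2 * Real.pi : ℂ) ^ (((k : ℂ) - 1) / 2) ≠ 0 := by
    rw [Ne, Complex.cpow_eq_zero_iff]
    exact fun h ↦ hpi h.1
  rw [normalizedL, ModularForm.L, Complex.Gammaℂ, gammaK, e]
  simp only [mul_inv, div_eq_mul_inv]
  field_simp

lemma isEntireContinuation_normalizedL (hk : 0 < k) (f : cuspSpace k χ) :
    IsEntireContinuation (coeffA k f.1) (normalizedL hk f) := by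
  constructor
  · unfold normalizedL
    exact (CuspForm.differentiable_L hk f.1).comp (by fun_prop)
  · refine ⟨3 / 2, fun s hs ↦ ?_⟩
    have hre : (k : ℝ) / 2 + 1 < (s + ((k : ℂ) - 1) / 2).re := by
      have : (s + ((k : ℂ) - 1) / 2).re = s.re + ((k : ℝ) - 1) / 2 := by simp
      rw [this]
      linarith
    have h := CuspForm.hasSum_L hk f.1 hre
    simp only [strictWidthInfty_Gamma1, Complex.ofReal_one, Complex.one_cpow, one_mul] at h
    refine h.congr_fun fun n ↦ ?_
    rw [LSeries.term_def]
    split_ifs with hn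
    · simp [hn, qExpansion_coeff_zero_eq_zero]
    · rw [coeffA, Complex.cpow_add _ _ (by exact_mod_cast hn), div_div, mul_comm]

lemma IsEntireContinuation.conj_conj {a : ℕ → ℂ} {L : ℂ → ℂ} (h : IsEntireContinuation a L) :
    IsEntireContinuation (fun n ↦ conj (a n)) (fun s ↦ conj (L (conj s))) := by
  obtain ⟨h1, σ, h2⟩ := h
  refine ⟨fun s ↦ by simpa [Function.comp_def] using (h1 (conj s)).conj_conj, σ, fun s hs ↦ ?_⟩
  have h := Complex.hasSum_conj'.mpr (h2 (conj s) (by simpa using hs))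
  refine h.congr_fun fun n ↦ ?_
  rw [LSeries.term_def, LSeries.term_def]
  split_ifs with hn
  · simp
  · rw [map_div₀, Complex.cpow_conj _ _ (by rw [Complex.natCast_arg]; exact Real.pi_pos.ne),
      Complex.conj_conj, Complex.conj_natCast]

end CuspForm

variable {k : ℤ} {D : ℕ} [NeZero D] {χ : DirichletCharacter ℂ D} in
/-- Functional equation of the completed `L`-function, in terms of the normalized variable. -/
lemma IsHeckeBasis.completed_functional_equation (hk : 0 < k) (hχ : χ.IsPrimitive)
    (hχk : χ (-1) = (-1) ^ k) {ι : Type*} {B : Module.Basis ι ℂ (cuspSpace k χ)}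
    (hB : IsHeckeBasis B) (i : ι) (s : ℂ) :
    ModularForm.Λ hk (B i).1 (s + ((k : ℂ) - 1) / 2) =
      Complex.I ^ k * χ (-1) * gaussEps χ * conj (coeffA k (B i).1 D) * (D : ℂ) ^ (1 / 2 - s) *
        conj (ModularForm.Λ hk (B i).1 (conj (1 - s) + ((k : ℂ) - 1) / 2)) := by
  have hD : (D : ℂ) ≠ 0 := NeZero.ne _
  have h := mellin_functional_equation (F := fun z ↦ (B i).1 (ofComplex z)) (fun z hz ↦ apply_neg_one_div hχ hχk
    (hasNebentypus_comp_ofComplex (B i)) (hasFourierExpansion_comp_ofComplex (B i))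
    (fun m n hm ↦ hB.qExpansion_coeff_mul i m n hm) (hB.conj_qExpansion_coeff i)
    (exists_apply_ofComplex_ne_zero B i) hz) (s + ((k : ℂ) - 1) / 2)
  have e1 : conj ((k : ℂ) - (s + ((k : ℂ) - 1) / 2)) = conj (1 - s) + ((k : ℂ) - 1) / 2 := by
    simp only [map_sub, map_add, map_div₀, map_one, Complex.conj_ofNat, map_intCast]
    ring
  have e2 : (-Complex.I : ℂ) ^ k = χ (-1) * Complex.I ^ k := by
    rw [hχk, ← mul_zpow, neg_one_mul]
  have e3 : (D : ℂ) ^ (s + ((k : ℂ) - 1) / 2) * (D : ℂ) ^ (1 / 2 - s) =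
      (D : ℂ) ^ (1 / 2 : ℂ) * (D : ℂ) ^ (((k : ℂ) - 1) / 2) := by
    rw [← Complex.cpow_add _ _ hD, ← Complex.cpow_add _ _ hD]
    congr 1
    ring
  have h0 : (D : ℂ) ^ (s + ((k : ℂ) - 1) / 2) ≠ 0 := by simp [Complex.cpow_eq_zero_iff, hD]
  rw [← CuspForm.Λ_eq_mellin hk (B i).1, e1, e2, gaussSum_eq_gaussEps_mul, qExpansion_coeff_eq,
    map_mul, conj_natCast_cpow] at h
  apply mul_left_cancel₀ h0
  rw [h]
  linear_combination -(Complex.I ^ k * χ (-1) * gaussEps χ * conj (coeffA k (B i).1 D) *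
    conj (ModularForm.Λ hk (B i).1 (conj (1 - s) + ((k : ℂ) - 1) / 2))) * e3

lemma conj_ofReal_cpow {x : ℝ} (hx : 0 ≤ x) (s : ℂ) : conj ((x : ℂ) ^ s) = (x : ℂ) ^ conj s := by
  rw [Complex.cpow_conj _ _ (by rw [Complex.arg_ofReal_of_nonneg hx]; exact Real.pi_pos.ne),
    Complex.conj_ofReal]

lemma gammaK_conj (k : ℤ) (s : ℂ) : gammaK k (conj s) = conj (gammaK k s) := by
  have h1 := conj_ofReal_cpow zero_le_two ((3 - (k : ℂ)) / 2)
  have h2 := conj_ofReal_cpow Real.two_pi_pos.le (-s)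
  push_cast at h1 h2
  simp only [map_div₀, map_sub, map_neg, Complex.conj_ofNat, map_intCast] at h1 h2
  rw [gammaK, gammaK, map_mul, map_mul, map_mul, h1, h2, ← Complex.Gamma_conj]
  simp [Complex.conj_ofNat]

lemma gammaK_ne_zero {k : ℤ} {s : ℂ} (hs : ∀ m : ℕ, s ≠ ((k : ℂ) + 1) / 2 + m) :
    gammaK k (1 - s) ≠ 0 := by
  have hpi : (2 * Real.pi : ℂ) ≠ 0 := by simp [Real.pi_ne_zero]
  rw [gammaK]
  refine mul_ne_zero (mul_ne_zero (mul_ne_zero ?_ ?_) ?_) (Complex.Gamma_ne_zero fun m hm ↦ ?_)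
  · simp [Complex.cpow_eq_zero_iff]
  · simp [Real.sqrt_eq_zero', Real.pi_pos]
  · rw [Ne, Complex.cpow_eq_zero_iff]
    exact fun h ↦ hpi h.1
  · exact hs m (by linear_combination -hm)

end HeckeFE

theorem theorem2 (D : ℕ) [NeZero D] (hD : 1 < D) (k : ℤ) (hk : 4 ≤ k)
    (χ : DirichletCharacter ℂ D) (hχ : χ.IsPrimitive) (hχk : χ (-1) = (-1) ^ k)
    {ι : Type*} (B : Module.Basis ι ℂ (HeckeFE.cuspSpace k χ)) (hB : HeckeFE.IsHeckeBasis B)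
    (i : ι) :
    ∃ L Lbar : ℂ → ℂ,
      HeckeFE.IsEntireContinuation (HeckeFE.coeffA k (B i).1) L ∧
      HeckeFE.IsEntireContinuation (fun n => conj (HeckeFE.coeffA k (B i).1 n)) Lbar ∧
      (∀ s : ℂ, Lbar s = conj (L (conj s))) ∧
      -- the functional equation, off the poles of `γ_k(1 - s)`
      (∀ s : ℂ, (∀ m : ℕ, s ≠ ((k : ℂ) + 1) / 2 + m) →
        L s = Complex.I ^ k * χ (-1) * HeckeFE.gaussEps χ *
          conj (HeckeFE.coeffA k (B i).1 D) * (D : ℂ) ^ (1 / 2 - s) *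
          (HeckeFE.gammaK k (1 - s) / HeckeFE.gammaK k s) * Lbar (1 - s)) ∧
      -- the same identity at every `s`, multiplied by the entire function `1 / γ_k(1 - s)`
      -- (Mathlib's `Γ` is `0` at its poles, so `(γ_k s)⁻¹` is the entire function `1 / γ_k`)
      (∀ s : ℂ,
        (HeckeFE.gammaK k (1 - s))⁻¹ * L s = Complex.I ^ k * χ (-1) * HeckeFE.gaussEps χ *
          conj (HeckeFE.coeffA k (B i).1 D) * (D : ℂ) ^ (1 / 2 - s) *
          (HeckeFE.gammaK k s)⁻¹ * Lbar (1 - s)) := by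
  have hk0 : 0 < k := by linarith
  set L := HeckeFE.normalizedL hk0 (B i) with hL
  have hfe (s : ℂ) :
      (HeckeFE.gammaK k (1 - s))⁻¹ * L s = Complex.I ^ k * χ (-1) * HeckeFE.gaussEps χ *
        conj (HeckeFE.coeffA k (B i).1 D) * (D : ℂ) ^ (1 / 2 - s) *
        (HeckeFE.gammaK k s)⁻¹ * conj (L (conj (1 - s))) := by
    -- the constant relating `L` to `Λ / γ_k` is real
    have h1 := HeckeFE.conj_ofReal_cpow zero_le_two ((3 - (k : ℂ)) / 2)
    have h2 := HeckeFE.conj_ofReal_cpow Real.two_pi_pos.le (((k : ℂ) - 1) / 2)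
    push_cast at h1 h2
    simp only [map_div₀, map_sub, map_one, Complex.conj_ofNat, map_intCast] at h1 h2
    rw [hL, HeckeFE.normalizedL_eq, HeckeFE.normalizedL_eq, HeckeFE.gammaK_conj,
      hB.completed_functional_equation hk0 hχ hχk i s]
    simp only [map_mul, map_inv₀, Complex.conj_conj, Complex.conj_ofReal, h1, h2]
    ring
  have hcont := HeckeFE.isEntireContinuation_normalizedL hk0 (B i)
  refine ⟨L, fun s ↦ conj (L (conj s)), hcont, hcont.conj_conj, fun _ ↦ rfl, fun s hs ↦ ?_, hfe⟩
  have h0 := HeckeFE.gammaK_ne_zero hs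
  have h := hfe s
  rw [inv_mul_eq_iff_eq_mul₀ h0] at h
  rw [h]
  ring
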